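/- Let $n,m\ge 1$. Let $C_n$ denote the little $n$-cubes operad: $C_n(j)$ is the space of $j$-tuples of rectilinear embeddings $x\mapsto (a_i+b_ix_i)_{i}$ ($b_i>0$) of $]0,1[^n$ into itself with pairwise disjoint images (in particular $C_n(0)$ is a point), topologized by the parameters $(a,b)$. Let $C_n\otimes C_m$ be the Boardman--Vogt tensor product of topological operads, i.e. the universal topological operad receiving morphisms $p\mapsto p\otimes 1$ from $C_n$ and $q\mapsto 1\otimes q$ from $C_m$ that satisfy the interchange relation $(p\otimes 1)\circ(1\otimes q,\dots,1\otimes q)=(1\otimes q)\circ(p\otimes 1,\dots,p\otimes 1)$ up to the evident permutation of the inputs. Let $\mu\colon C_n\otimes C_m\to C_{n+m}$ be the morphism of topological operads which sends $p\otimes 1$ to the configuration with cubes $p_i\times\,]0,1[^m$ and $1\otimes q$ to the configuration with cubes $]0,1[^n\times q_i$. Let $C_n|C_m\subseteq C_{n+m}$ be the image of $\mu$, where each $(C_n|C_m)(j)$ has the subspace topology, and let $\mu'\colon C_n\otimes C_m\to C_n|C_m$ be the induced morphism. Then for every $j\ge 1$ the map $\mu'\colon (C_n\otimes C_m)(j)\to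 (C_n|C_m)(j)$ is proper, i.e. it is continuous and the preimage of every compact subset is compact. -/

import Mathlib

noncomputable section

universe u v w

/-! ## Symmetric operads -/

/-- An (uncoloured, symmetric) operad in sets.  `Op j` is the set of operations of arity `j`.
`comp a e p q` is the operadic composite `p ∘ (q₁, …, q_k)`, where `q i` has arity `a i`, with its
inputs relabelled along the bijection `e` (the `x`-th input of `q i` becomes input number
`e ⟨i, x⟩`).  Thus `comp` packages the usual composition maps together with the actions of the
symmetric groups: the action of a permutation `σ` on `p` is `comp (fun _ => 1) e p (fun _ => one)`
with `e ⟨i, 0⟩ = σ i`, the usual composition is the one in which `e` is the lexicographic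
bijection, and associativity for all relabellings contains the usual equivariance axioms. -/
structure Operad where
  Op : ℕ → Type u
  one : Op 1
  comp : ∀ {k j : ℕ} (a : Fin k → ℕ) (_ : (Σ i : Fin k, Fin (a i)) ≃ Fin j),
    Op k → (∀ i, Op (a i)) → Op j
  comp_one : ∀ {k : ℕ} (e : (Σ _ : Fin k, Fin 1) ≃ Fin k), (∀ i, e ⟨i, 0⟩ = i) →
    ∀ p : Op k, comp (fun _ => 1) e p (fun _ => one) = p
  one_comp : ∀ {j : ℕ} (e : (Σ _ : Fin 1, Fin j) ≃ Fin j), (∀ x, e ⟨0, x⟩ = x) →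
    ∀ q : Op j, comp (fun _ => j) e one (fun _ => q) = q
  assoc : ∀ {k j l : ℕ} (a : Fin k → ℕ) (f : (Σ i : Fin k, Fin (a i)) ≃ Fin j)
    (b : Fin j → ℕ) (e : (Σ s : Fin j, Fin (b s)) ≃ Fin l)
    (c : Fin k → ℕ) (g : ∀ i : Fin k, (Σ x : Fin (a i), Fin (b (f ⟨i, x⟩))) ≃ Fin (c i))
    (h : (Σ i : Fin k, Fin (c i)) ≃ Fin l),
    (∀ i x y, h ⟨i, g i ⟨x, y⟩⟩ = e ⟨f ⟨i, x⟩, y⟩) →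
    ∀ (p : Op k) (q : ∀ i, Op (a i)) (r : ∀ s, Op (b s)),
      comp b e (comp a f p q) r =
        comp c h p (fun i =>
          comp (fun x => b (f ⟨i, x⟩)) (g i) (q i) (fun x => r (f ⟨i, x⟩)))

/-- Morphisms of operads in sets. -/
structure Operad.Hom (P : Operad.{u}) (Q : Operad.{v}) where
  map : ∀ j, P.Op j → Q.Op j
  map_one : map 1 P.one = Q.one
  map_comp : ∀ {k j : ℕ} (a : Fin k → ℕ) (e : (Σ i : Fin k, Fin (a i)) ≃ Fin j)
    (p : P.Op k) (q : ∀ i, P.Op (a i)),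
    map j (P.comp a e p q) = Q.comp a e (map k p) (fun i => map (a i) (q i))

/-- A family of topologies on the sets of operations for which all the (relabelled) composition
maps are continuous. -/
def Operad.IsOperadTopology (P : Operad.{u}) (t : ∀ j, TopologicalSpace (P.Op j)) : Prop :=
  letI := t
  ∀ {k j : ℕ} (a : Fin k → ℕ) (e : (Σ i : Fin k, Fin (a i)) ≃ Fin j),
    Continuous (fun x : P.Op k × (∀ i, P.Op (a i)) => P.comp a e x.1 x.2)

/-- A topological operad. -/
structure TopOperad extends Operad.{u} where
  top : ∀ j, TopologicalSpace (Op j)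
  isOperadTopology : toOperad.IsOperadTopology top

instance (P : TopOperad.{u}) (j : ℕ) : TopologicalSpace (P.Op j) := P.top j

/-- Morphisms of topological operads. -/
structure TopOperad.Hom (P : TopOperad.{u}) (Q : TopOperad.{v}) extends
    Operad.Hom P.toOperad Q.toOperad where
  continuous_map : ∀ j, Continuous (map j)

/-! ## The Boardman–Vogt tensor product -/

namespace BoardmanVogt

/-- Formal composites of operations of `P` (written `p ⊗ 1`) and of `Q` (written `1 ⊗ q`). -/
inductive Word (P : Operad.{u}) (Q : Operad.{v}) : ℕ → Type (max u v)
  | one : Word P Q 1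
  | inl {j : ℕ} (p : P.Op j) : Word P Q j
  | inr {j : ℕ} (q : Q.Op j) : Word P Q j
  | comp {k j : ℕ} (a : Fin k → ℕ) (e : (Σ i : Fin k, Fin (a i)) ≃ Fin j)
      (t : Word P Q k) (s : ∀ i, Word P Q (a i)) : Word P Q j

/-- The operadic congruence generated by: the operad axioms, the requirement that `p ↦ p ⊗ 1` and
`q ↦ 1 ⊗ q` are morphisms of operads, and the interchange relation
`(p ⊗ 1) ∘ (1 ⊗ q, …, 1 ⊗ q) = (1 ⊗ q) ∘ (p ⊗ 1, …, p ⊗ 1)` up to the evident shuffle. -/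
inductive Rel (P : Operad.{u}) (Q : Operad.{v}) : ∀ {j : ℕ}, Word P Q j → Word P Q j → Prop
  | refl {j : ℕ} (t : Word P Q j) : Rel P Q t t
  | symm {j : ℕ} {t s : Word P Q j} : Rel P Q t s → Rel P Q s t
  | trans {j : ℕ} {t s r : Word P Q j} : Rel P Q t s → Rel P Q s r → Rel P Q t r
  | congr {k j : ℕ} (a : Fin k → ℕ) (e : (Σ i : Fin k, Fin (a i)) ≃ Fin j)
      {t t' : Word P Q k} {s s' : ∀ i, Word P Q (a i)} :
      Rel P Q t t' → (∀ i, Rel P Q (s i) (s' i)) → Rel P Q (.comp a e t s) (.comp a e t' s')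
  | comp_one {k : ℕ} (e : (Σ _ : Fin k, Fin 1) ≃ Fin k) (he : ∀ i, e ⟨i, 0⟩ = i)
      (t : Word P Q k) : Rel P Q (.comp (fun _ => 1) e t (fun _ => .one)) t
  | one_comp {j : ℕ} (e : (Σ _ : Fin 1, Fin j) ≃ Fin j) (he : ∀ x, e ⟨0, x⟩ = x)
      (s : Word P Q j) : Rel P Q (.comp (fun _ => j) e .one (fun _ => s)) s
  | assoc {k j l : ℕ} (a : Fin k → ℕ) (f : (Σ i : Fin k, Fin (a i)) ≃ Fin j)
      (b : Fin j → ℕ) (e : (Σ s : Fin j, Fin (b s)) ≃ Fin l)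
      (c : Fin k → ℕ) (g : ∀ i : Fin k, (Σ x : Fin (a i), Fin (b (f ⟨i, x⟩))) ≃ Fin (c i))
      (h : (Σ i : Fin k, Fin (c i)) ≃ Fin l)
      (hyp : ∀ i x y, h ⟨i, g i ⟨x, y⟩⟩ = e ⟨f ⟨i, x⟩, y⟩)
      (p : Word P Q k) (q : ∀ i, Word P Q (a i)) (r : ∀ s, Word P Q (b s)) :
      Rel P Q (.comp b e (.comp a f p q) r)
        (.comp c h p (fun i =>
          .comp (fun x => b (f ⟨i, x⟩)) (g i) (q i) (fun x => r (f ⟨i, x⟩))))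
  | inl_one : Rel P Q (.inl P.one) .one
  | inr_one : Rel P Q (.inr Q.one) .one
  | inl_comp {k j : ℕ} (a : Fin k → ℕ) (e : (Σ i : Fin k, Fin (a i)) ≃ Fin j)
      (p : P.Op k) (q : ∀ i, P.Op (a i)) :
      Rel P Q (.inl (P.comp a e p q)) (.comp a e (.inl p) (fun i => .inl (q i)))
  | inr_comp {k j : ℕ} (a : Fin k → ℕ) (e : (Σ i : Fin k, Fin (a i)) ≃ Fin j)
      (p : Q.Op k) (q : ∀ i, Q.Op (a i)) :
      Rel P Q (.inr (Q.comp a e p q)) (.comp a e (.inr p) (fun i => .inr (q i)))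
  | interchange {a b j : ℕ} (e : (Σ _ : Fin a, Fin b) ≃ Fin j) (e' : (Σ _ : Fin b, Fin a) ≃ Fin j)
      (hyp : ∀ x y, e ⟨x, y⟩ = e' ⟨y, x⟩) (p : P.Op a) (q : Q.Op b) :
      Rel P Q (.comp (fun _ => b) e (.inl p) (fun _ => .inr q))
        (.comp (fun _ => a) e' (.inr q) (fun _ => .inl p))

/-- The relation `Rel` as a setoid. -/
def wordSetoid (P : Operad.{u}) (Q : Operad.{v}) (j : ℕ) : Setoid (Word P Q j) where
  r := Rel P Q
  iseqv := ⟨Rel.refl, Rel.symm, Rel.trans⟩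

/-- Operations of arity `j` in the tensor product. -/
def TOp (P : Operad.{u}) (Q : Operad.{v}) (j : ℕ) : Type (max u v) :=
  Quotient (wordSetoid P Q j)

variable {P : Operad.{u}} {Q : Operad.{v}}

/-- The class of a formal composite. -/
def mk {j : ℕ} (t : Word P Q j) : TOp P Q j := Quotient.mk (wordSetoid P Q j) t

theorem mk_eq {j : ℕ} {t s : Word P Q j} (h : Rel P Q t s) : mk t = mk s :=
  Quotient.sound (s := wordSetoid P Q j) h

/-- A representative of a class. -/
def rep {j : ℕ} (x : TOp P Q j) : Word P Q j := Quotient.out (s := wordSetoid P Q j) x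

theorem mk_rep {j : ℕ} (x : TOp P Q j) : mk (rep x) = x :=
  Quotient.out_eq (s := wordSetoid P Q j) x

theorem rel_rep_mk {j : ℕ} (t : Word P Q j) : Rel P Q (rep (mk t)) t :=
  Quotient.exact (s := wordSetoid P Q j) (mk_rep (mk t))

/-- Composition in the tensor product, induced by composition of formal composites. -/
def tcomp {k j : ℕ} (a : Fin k → ℕ) (e : (Σ i : Fin k, Fin (a i)) ≃ Fin j)
    (t : TOp P Q k) (s : ∀ i, TOp P Q (a i)) : TOp P Q j :=
  mk (.comp a e (rep t) (fun i => rep (s i)))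

theorem tcomp_mk {k j : ℕ} (a : Fin k → ℕ) (e : (Σ i : Fin k, Fin (a i)) ≃ Fin j)
    (t : Word P Q k) (s : ∀ i, Word P Q (a i)) :
    tcomp a e (mk t) (fun i => mk (s i)) = mk (.comp a e t s) :=
  mk_eq (.congr a e (rel_rep_mk t) (fun i => rel_rep_mk (s i)))

variable (P Q)

/-- The Boardman–Vogt tensor product of the underlying operads in sets. -/
def tensorOperad : Operad.{max u v} where
  Op := TOp P Q
  one := mk .one
  comp := tcomp
  comp_one e he p := by
    rw [← mk_rep p]
    exact (tcomp_mk _ e _ _).trans (mk_eq (.comp_one e he _))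
  one_comp e he q := by
    rw [← mk_rep q]
    exact (tcomp_mk _ e _ _).trans (mk_eq (.one_comp e he _))
  assoc a f b e c g h hyp p q r := by
    have hq : ∃ q' : ∀ i, Word P Q (a i), q = fun i => mk (q' i) :=
      ⟨fun i => rep (q i), funext fun i => (mk_rep _).symm⟩
    have hr : ∃ r' : ∀ i, Word P Q (b i), r = fun i => mk (r' i) :=
      ⟨fun i => rep (r i), funext fun i => (mk_rep _).symm⟩
    obtain ⟨q', rfl⟩ := hq
    obtain ⟨r', rfl⟩ := hr
    rw [← mk_rep p]
    simp only [tcomp_mk]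
    exact mk_eq (.assoc a f b e c g h hyp _ q' r')

/-- The morphism `p ↦ p ⊗ 1`. -/
def inl : Operad.Hom P (tensorOperad P Q) where
  map _ p := mk (.inl p)
  map_one := mk_eq .inl_one
  map_comp a e p q := (mk_eq (.inl_comp a e p q)).trans (tcomp_mk a e _ _).symm

/-- The morphism `q ↦ 1 ⊗ q`. -/
def inr : Operad.Hom Q (tensorOperad P Q) where
  map _ p := mk (.inr p)
  map_one := mk_eq .inr_one
  map_comp a e p q := (mk_eq (.inr_comp a e p q)).trans (tcomp_mk a e _ _).symm

variable {P Q}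

/-- Two morphisms with a common target interchange. -/
def Interchange {R : Operad.{w}} (f : Operad.Hom P R) (g : Operad.Hom Q R) : Prop :=
  ∀ {a b j : ℕ} (e : (Σ _ : Fin a, Fin b) ≃ Fin j) (e' : (Σ _ : Fin b, Fin a) ≃ Fin j),
    (∀ x y, e ⟨x, y⟩ = e' ⟨y, x⟩) → ∀ (p : P.Op a) (q : Q.Op b),
      R.comp (fun _ => b) e (f.map a p) (fun _ => g.map b q) =
        R.comp (fun _ => a) e' (g.map b q) (fun _ => f.map a p)

/-- Evaluation of a formal composite in an operad receiving morphisms from `P` and `Q`. -/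
def Word.eval {R : Operad.{w}} (f : Operad.Hom P R) (g : Operad.Hom Q R) :
    ∀ {j : ℕ}, Word P Q j → R.Op j
  | _, .one => R.one
  | j, .inl p => f.map j p
  | j, .inr q => g.map j q
  | _, .comp a e t s => R.comp a e (t.eval f g) (fun i => (s i).eval f g)

theorem Rel.eval_eq {R : Operad.{w}} {f : Operad.Hom P R} {g : Operad.Hom Q R}
    (hfg : Interchange f g) {j : ℕ} {t s : Word P Q j} (h : Rel P Q t s) :
    t.eval f g = s.eval f g := by
  induction h with
  | refl t => rfl
  | symm _ ih => exact ih.symm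
  | trans _ _ ih₁ ih₂ => exact ih₁.trans ih₂
  | congr a e _ _ ih₁ ih₂ => simp only [Word.eval, ih₁, ih₂]
  | comp_one e he t => exact R.comp_one e he _
  | one_comp e he s => exact R.one_comp e he _
  | assoc a f b e c g h hyp p q r => exact R.assoc a f b e c g h hyp _ _ _
  | inl_one => exact f.map_one
  | inr_one => exact g.map_one
  | inl_comp a e p q => exact f.map_comp a e p q
  | inr_comp a e p q => exact g.map_comp a e p q
  | interchange e e' hyp p q => exact hfg e e' hyp p q

/-- The morphism out of the tensor product induced by two interchanging morphisms. -/
def liftHom {R : Operad.{w}} (f : Operad.Hom P R) (g : Operad.Hom Q R) (hfg : Interchange f g) :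
    Operad.Hom (tensorOperad P Q) R where
  map j := Quotient.lift (s := wordSetoid P Q j) (fun t => t.eval f g)
    (fun _ _ h => Rel.eval_eq hfg h)
  map_one := rfl
  map_comp {k j} a e p q := by
    rw [← mk_rep p]
    have hq' : ∃ q' : ∀ i, Word P Q (a i), q = fun i => mk (q' i) :=
      ⟨fun i => rep (q i), funext fun i => (mk_rep _).symm⟩
    obtain ⟨q', rfl⟩ := hq'
    change Quotient.lift (s := wordSetoid P Q j) _ _ (tcomp a e _ _) = _
    rw [tcomp_mk]
    rfl

end BoardmanVogt

namespace TopOperad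

open BoardmanVogt

/-- The families of topologies on the Boardman–Vogt tensor product for which it is a topological
operad and `p ↦ p ⊗ 1`, `q ↦ 1 ⊗ q` are continuous. -/
def Admissible (P : TopOperad.{u}) (Q : TopOperad.{v})
    (t : ∀ j, TopologicalSpace ((tensorOperad P.toOperad Q.toOperad).Op j)) : Prop :=
  (tensorOperad P.toOperad Q.toOperad).IsOperadTopology t ∧
    (∀ j, @Continuous _ _ (P.top j) (t j) ((inl P.toOperad Q.toOperad).map j)) ∧
    (∀ j, @Continuous _ _ (Q.top j) (t j) ((inr P.toOperad Q.toOperad).map j))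

/-- The topology of the Boardman–Vogt tensor product: the finest admissible one (recall that in
Mathlib the order on topologies is such that `≤` means "finer than"). -/
@[reducible] def tensorTop (P : TopOperad.{u}) (Q : TopOperad.{v}) (j : ℕ) :
    TopologicalSpace ((tensorOperad P.toOperad Q.toOperad).Op j) :=
  ⨅ t : {t : ∀ j, TopologicalSpace ((tensorOperad P.toOperad Q.toOperad).Op j) // Admissible P Q t}, t.1 j

theorem tensorTop_le {P : TopOperad.{u}} {Q : TopOperad.{v}}
    {t : ∀ j, TopologicalSpace ((tensorOperad P.toOperad Q.toOperad).Op j)} (ht : Admissible P Q t) (j : ℕ) :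
    tensorTop P Q j ≤ t j :=
  iInf_le (fun t : {t : ∀ j, TopologicalSpace ((tensorOperad P.toOperad Q.toOperad).Op j) //
    Admissible P Q t} => t.1 j) ⟨t, ht⟩

theorem admissible_tensorTop (P : TopOperad.{u}) (Q : TopOperad.{v}) :
    Admissible P Q (tensorTop P Q) := by
  refine ⟨?_, fun j => ?_, fun j => ?_⟩
  · intro k j a e
    refine continuous_iInf_rng.2 fun t => ?_
    have h := t.2.1 a e
    refine continuous_le_dom ?_ h
    refine inf_le_inf (induced_mono (tensorTop_le t.2 k)) (induced_mono ?_)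
    exact iInf_mono fun i => induced_mono (tensorTop_le t.2 (a i))
  · exact continuous_iInf_rng.2 fun t => t.2.2.1 j
  · exact continuous_iInf_rng.2 fun t => t.2.2.2 j

/-- The Boardman–Vogt tensor product of topological operads. -/
def tensor (P : TopOperad.{u}) (Q : TopOperad.{v}) : TopOperad.{max u v} where
  toOperad := tensorOperad P.toOperad Q.toOperad
  top := tensorTop P Q
  isOperadTopology := (admissible_tensorTop P Q).1

/-- The morphism of topological operads out of the tensor product induced by two interchanging
morphisms of topological operads. -/
def tensorLift {P : TopOperad.{u}} {Q : TopOperad.{v}} {R : TopOperad.{w}}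
    (f : Hom P R) (g : Hom Q R) (hfg : Interchange f.toHom g.toHom) :
    Hom (tensor P Q) R where
  toHom := liftHom f.toHom g.toHom hfg
  continuous_map j := by
    let F := liftHom f.toHom g.toHom hfg
    let t : ∀ j, TopologicalSpace ((tensorOperad P.toOperad Q.toOperad).Op j) :=
      fun j => (R.top j).induced (F.map j)
    have ht : Admissible P Q t := by
      refine ⟨?_, fun j => ?_, fun j => ?_⟩
      · intro k j a e
        refine continuous_induced_rng.2 ?_
        have h1 : ∀ j, @Continuous _ _ (t j) (R.top j) (F.map j) :=
          fun j => continuous_induced_dom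
        have h : (F.map j ∘ fun x : (tensorOperad P.toOperad Q.toOperad).Op k ×
            (∀ i, (tensorOperad P.toOperad Q.toOperad).Op (a i)) =>
              (tensorOperad P.toOperad Q.toOperad).comp a e x.1 x.2) =
            (fun y : R.Op k × (∀ i, R.Op (a i)) => R.comp a e y.1 y.2) ∘
              (fun x => (F.map k x.1, fun i => F.map (a i) (x.2 i))) :=
          funext fun x => F.map_comp a e x.1 x.2
        rw [h]
        refine (R.isOperadTopology a e).comp ?_
        let := t
        exact ((h1 k).comp continuous_fst).prodMk
          (continuous_pi fun i => (h1 (a i)).comp ((continuous_apply i).comp continuous_snd))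
      · exact continuous_induced_rng.2 (f.continuous_map j)
      · exact continuous_induced_rng.2 (g.continuous_map j)
    exact continuous_le_dom (tensorTop_le ht j) continuous_induced_dom

end TopOperad

/-! ## The little cubes operads -/

/-- A little `n`-cube: a pair `(a, b)` of vectors encoding the rectilinear embedding
`x ↦ (a i + b i * x i)` of the open unit cube into itself (so `b i > 0`). -/
abbrev LittleCube (n : ℕ) : Type :=
  {c : (Fin n → ℝ) × (Fin n → ℝ) // ∀ i, 0 ≤ c.1 i ∧ 0 < c.2 i ∧ c.1 i + c.2 i ≤ 1}

/-- The open unit cube. -/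
def openCube (n : ℕ) : Set (Fin n → ℝ) := {x | ∀ i, 0 < x i ∧ x i < 1}

namespace LittleCube

variable {n m : ℕ}

/-- The embedding encoded by a little cube. -/
def toFun (c : LittleCube n) (x : Fin n → ℝ) : Fin n → ℝ := fun i => c.1.1 i + c.1.2 i * x i

/-- The image of the open unit cube. -/
def image (c : LittleCube n) : Set (Fin n → ℝ) := c.toFun '' openCube n

theorem ext' {c d : LittleCube n} (h₁ : ∀ i, c.1.1 i = d.1.1 i) (h₂ : ∀ i, c.1.2 i = d.1.2 i) :
    c = d := Subtype.ext (Prod.ext (funext h₁) (funext h₂))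

/-- The identity embedding. -/
def one (n : ℕ) : LittleCube n := ⟨(fun _ => 0, fun _ => 1), fun _ => by norm_num⟩

/-- Composition of embeddings. -/
def comp (c d : LittleCube n) : LittleCube n :=
  ⟨(fun i => c.1.1 i + c.1.2 i * d.1.1 i, fun i => c.1.2 i * d.1.2 i), fun i => by
    obtain ⟨h1, h2, h3⟩ := c.2 i
    obtain ⟨h4, h5, h6⟩ := d.2 i
    exact ⟨by positivity, by positivity, by nlinarith⟩⟩

theorem toFun_comp (c d : LittleCube n) (x : Fin n → ℝ) :
    (c.comp d).toFun x = c.toFun (d.toFun x) := by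
  funext i; simp only [comp, toFun]; ring

theorem toFun_injective (c : LittleCube n) : Function.Injective c.toFun := by
  intro x y h
  funext i
  have := congrFun h i
  simp only [toFun] at this
  exact mul_left_cancel₀ (c.2 i).2.1.ne' (add_left_cancel this)

theorem image_comp (c d : LittleCube n) : (c.comp d).image = c.toFun '' d.image := by
  simp only [image, Set.image_image, toFun_comp]

theorem image_subset (c : LittleCube n) : c.image ⊆ openCube n := by
  rintro _ ⟨x, hx, rfl⟩ i
  obtain ⟨h1, h2, h3⟩ := c.2 i
  obtain ⟨h4, h5⟩ := hx i
  simp only [toFun]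
  constructor <;> nlinarith

theorem image_comp_subset (c d : LittleCube n) : (c.comp d).image ⊆ c.image := by
  rw [image_comp]; exact Set.image_mono d.image_subset

/-- The cube `c × ]0,1[^m`. -/
def extendRight (m : ℕ) (c : LittleCube n) : LittleCube (n + m) :=
  ⟨(Fin.append c.1.1 (fun _ => 0), Fin.append c.1.2 (fun _ => 1)), fun i => by
    refine Fin.addCases (fun i => ?_) (fun i => ?_) i
    · simpa using c.2 i
    · simp⟩

/-- The cube `]0,1[^n × c`. -/
def extendLeft (n : ℕ) (c : LittleCube m) : LittleCube (n + m) :=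
  ⟨(Fin.append (fun _ => 0) c.1.1, Fin.append (fun _ => 1) c.1.2), fun i => by
    refine Fin.addCases (fun i => ?_) (fun i => ?_) i
    · simp
    · simpa using c.2 i⟩

end LittleCube

/-- Configurations of `j` little `n`-cubes with pairwise disjoint images of the open unit cube,
topologized as a subspace of `((ℝⁿ × ℝⁿ)^j)`. -/
abbrev Cubes (n j : ℕ) : Type :=
  {c : Fin j → LittleCube n // Pairwise fun x y => Disjoint (c x).image (c y).image}

namespace Cubes

variable {n : ℕ}

/-- Composition of configurations. -/
def comp {k j : ℕ} (a : Fin k → ℕ) (e : (Σ i : Fin k, Fin (a i)) ≃ Fin j)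
    (p : Cubes n k) (q : ∀ i, Cubes n (a i)) : Cubes n j :=
  ⟨fun z => (p.1 (e.symm z).1).comp ((q (e.symm z).1).1 (e.symm z).2), by
    have key : ∀ s s' : (Σ i : Fin k, Fin (a i)), s ≠ s' →
        Disjoint ((p.1 s.1).comp ((q s.1).1 s.2)).image
          ((p.1 s'.1).comp ((q s'.1).1 s'.2)).image := by
      rintro ⟨i, x⟩ ⟨i', x'⟩ hs
      by_cases h : i = i'
      · subst h
        have hx : x ≠ x' := fun h => hs (by rw [h])
        simp only [LittleCube.image_comp]
        exact Set.disjoint_image_of_injective (LittleCube.toFun_injective _) ((q i).2 hx)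
      · exact (p.2 h).mono (LittleCube.image_comp_subset _ _) (LittleCube.image_comp_subset _ _)
    exact fun z z' hz => key _ _ fun h => hz (e.symm.injective h)⟩

theorem comp_apply {k j : ℕ} (a : Fin k → ℕ) (e : (Σ i : Fin k, Fin (a i)) ≃ Fin j)
    (p : Cubes n k) (q : ∀ i, Cubes n (a i)) (i : Fin k) (x : Fin (a i)) :
    (comp a e p q).1 (e ⟨i, x⟩) = (p.1 i).comp ((q i).1 x) := by
  simp only [comp]
  rw [e.symm_apply_apply]

theorem ext_equiv {k j : ℕ} {a : Fin k → ℕ} (e : (Σ i : Fin k, Fin (a i)) ≃ Fin j)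
    {c d : Cubes n j} (h : ∀ i x, c.1 (e ⟨i, x⟩) = d.1 (e ⟨i, x⟩)) : c = d := by
  refine Subtype.ext (funext fun z => ?_)
  have := h (e.symm z).1 (e.symm z).2
  simpa using this

/-- The configuration consisting of the identity embedding. -/
def one (n : ℕ) : Cubes n 1 :=
  ⟨fun _ => LittleCube.one n, fun x y h => absurd (Subsingleton.elim x y) h⟩

theorem continuous_cube (j : ℕ) (x : Fin j) : Continuous fun c : Cubes n j => (c.1 x).1 :=
  continuous_subtype_val.comp ((continuous_apply x).comp continuous_subtype_val)

theorem continuous_comp {k j : ℕ} (a : Fin k → ℕ) (e : (Σ i : Fin k, Fin (a i)) ≃ Fin j) :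
    Continuous fun x : Cubes n k × (∀ i, Cubes n (a i)) => comp a e x.1 x.2 := by
  refine Continuous.subtype_mk (continuous_pi fun z => ?_) _
  have hp : Continuous fun x : Cubes n k × (∀ i, Cubes n (a i)) => (x.1.1 (e.symm z).1).1 :=
    (continuous_cube _ _).comp continuous_fst
  have hq : Continuous fun x : Cubes n k × (∀ i, Cubes n (a i)) =>
      ((x.2 (e.symm z).1).1 (e.symm z).2).1 :=
    (continuous_cube _ _).comp ((continuous_apply _).comp continuous_snd)
  refine Continuous.subtype_mk (Continuous.prodMk ?_ ?_) _
  · refine continuous_pi fun i => ?_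
    exact ((continuous_apply i).comp hp.fst).add
      (((continuous_apply i).comp hp.snd).mul ((continuous_apply i).comp hq.fst))
  · refine continuous_pi fun i => ?_
    exact ((continuous_apply i).comp hp.snd).mul ((continuous_apply i).comp hq.snd)

/-- `c ↦ c × ]0,1[^m` on each cube of a configuration. -/
def extendRight (m : ℕ) {j : ℕ} (c : Cubes n j) : Cubes (n + m) j :=
  ⟨fun x => (c.1 x).extendRight m, fun x y hxy => by
    refine Set.disjoint_left.2 ?_
    rintro _ ⟨s, hs, rfl⟩ ⟨t, ht, h⟩
    refine Set.disjoint_left.1 (c.2 hxy)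
      ⟨fun i => s (Fin.castAdd m i), fun i => hs _, rfl⟩
      ⟨fun i => t (Fin.castAdd m i), fun i => ht _, funext fun i => ?_⟩
    simpa [LittleCube.toFun, LittleCube.extendRight] using congrFun h (Fin.castAdd m i)⟩

/-- `c ↦ ]0,1[^m × c` on each cube of a configuration. -/
def extendLeft (m : ℕ) {j : ℕ} (c : Cubes n j) : Cubes (m + n) j :=
  ⟨fun x => (c.1 x).extendLeft m, fun x y hxy => by
    refine Set.disjoint_left.2 ?_
    rintro _ ⟨s, hs, rfl⟩ ⟨t, ht, h⟩
    refine Set.disjoint_left.1 (c.2 hxy)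
      ⟨fun i => s (Fin.natAdd m i), fun i => hs _, rfl⟩
      ⟨fun i => t (Fin.natAdd m i), fun i => ht _, funext fun i => ?_⟩
    simpa [LittleCube.toFun, LittleCube.extendLeft] using congrFun h (Fin.natAdd m i)⟩

theorem continuous_extendRight (m j : ℕ) :
    Continuous (extendRight m : Cubes n j → Cubes (n + m) j) := by
  refine Continuous.subtype_mk (continuous_pi fun x => ?_) _
  have hc := continuous_cube (n := n) j x
  refine Continuous.subtype_mk (Continuous.prodMk (continuous_pi fun i => ?_)
    (continuous_pi fun i => ?_)) _
  · refine Fin.addCases (fun i => ?_) (fun i => ?_) i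
    · simpa [LittleCube.extendRight, Function.comp_def] using (continuous_apply i).comp hc.fst
    · simpa using continuous_const
  · refine Fin.addCases (fun i => ?_) (fun i => ?_) i
    · simpa [LittleCube.extendRight, Function.comp_def] using (continuous_apply i).comp hc.snd
    · simpa using continuous_const

theorem continuous_extendLeft (m j : ℕ) :
    Continuous (extendLeft m : Cubes n j → Cubes (m + n) j) := by
  refine Continuous.subtype_mk (continuous_pi fun x => ?_) _
  have hc := continuous_cube (n := n) j x
  refine Continuous.subtype_mk (Continuous.prodMk (continuous_pi fun i => ?_)
    (continuous_pi fun i => ?_)) _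
  · refine Fin.addCases (fun i => ?_) (fun i => ?_) i
    · simpa using continuous_const
    · simpa [LittleCube.extendRight, Function.comp_def] using (continuous_apply i).comp hc.fst
  · refine Fin.addCases (fun i => ?_) (fun i => ?_) i
    · simpa using continuous_const
    · simpa [LittleCube.extendRight, Function.comp_def] using (continuous_apply i).comp hc.snd

end Cubes

/-- The little `n`-cubes operad `C_n`. -/
def littleCubes (n : ℕ) : TopOperad.{0} where
  Op := Cubes n
  one := Cubes.one n
  comp := Cubes.comp
  comp_one e he p := by
    refine Cubes.ext_equiv e fun i x => ?_
    rw [Cubes.comp_apply, Subsingleton.elim x 0, he]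
    exact LittleCube.ext' (by simp [Cubes.one, LittleCube.comp, LittleCube.one])
      (by simp [Cubes.one, LittleCube.comp, LittleCube.one])
  one_comp e he q := by
    refine Cubes.ext_equiv e fun i x => ?_
    rw [Cubes.comp_apply, Subsingleton.elim i 0, he]
    exact LittleCube.ext' (by simp [Cubes.one, LittleCube.comp, LittleCube.one])
      (by simp [Cubes.one, LittleCube.comp, LittleCube.one])
  assoc a f b e c g h hyp p q r := by
    refine Cubes.ext_equiv h fun i z => ?_
    obtain ⟨⟨x, y⟩, rfl⟩ := (g i).surjective z
    rw [Cubes.comp_apply, Cubes.comp_apply, hyp, Cubes.comp_apply, Cubes.comp_apply]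
    exact LittleCube.ext' (fun _ => by simp only [LittleCube.comp]; ring)
      (fun _ => by simp only [LittleCube.comp]; ring)
  top j := inferInstanceAs (TopologicalSpace (Cubes n j))
  isOperadTopology := Cubes.continuous_comp

/-! ## The comparison map -/

/-- The morphism `μ₁ : C_n → C_{n+m}`, `c ↦ c × ]0,1[^m` on each cube. -/
def mu₁ (n m : ℕ) : TopOperad.Hom (littleCubes n) (littleCubes (n + m)) where
  map j := (Cubes.extendRight m : Cubes n j → Cubes (n + m) j)
  map_one := by
    refine Subtype.ext (funext fun x => LittleCube.ext' (fun i => ?_) (fun i => ?_)) <;>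
    · refine Fin.addCases (fun i => ?_) (fun i => ?_) i <;>
        simp [littleCubes, Cubes.extendRight, Cubes.one, LittleCube.one, LittleCube.extendRight]
  map_comp a e p q := by
    refine Subtype.ext (funext fun x => LittleCube.ext' (fun i => ?_) (fun i => ?_)) <;>
    · refine Fin.addCases (fun i => ?_) (fun i => ?_) i <;>
        simp [littleCubes, Cubes.extendRight, Cubes.comp, LittleCube.comp, LittleCube.extendRight]
  continuous_map j := Cubes.continuous_extendRight m j

/-- The morphism `μ₂ : C_m → C_{n+m}`, `c ↦ ]0,1[^n × c` on each cube. -/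
def mu₂ (n m : ℕ) : TopOperad.Hom (littleCubes m) (littleCubes (n + m)) where
  map j := (Cubes.extendLeft n : Cubes m j → Cubes (n + m) j)
  map_one := by
    refine Subtype.ext (funext fun x => LittleCube.ext' (fun i => ?_) (fun i => ?_)) <;>
    · refine Fin.addCases (fun i => ?_) (fun i => ?_) i <;>
        simp [littleCubes, Cubes.extendLeft, Cubes.one, LittleCube.one, LittleCube.extendLeft]
  map_comp a e p q := by
    refine Subtype.ext (funext fun x => LittleCube.ext' (fun i => ?_) (fun i => ?_)) <;>
    · refine Fin.addCases (fun i => ?_) (fun i => ?_) i <;>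
        simp [littleCubes, Cubes.extendLeft, Cubes.comp, LittleCube.comp, LittleCube.extendLeft]
  continuous_map j := Cubes.continuous_extendLeft n j

theorem interchange_mu (n m : ℕ) :
    BoardmanVogt.Interchange (mu₁ n m).toHom (mu₂ n m).toHom := by
  intro a b j e e' hyp (p : Cubes n a) (q : Cubes m b)
  change Cubes.comp (fun _ => b) e (Cubes.extendRight m p) (fun _ => Cubes.extendLeft n q) =
    Cubes.comp (fun _ => a) e' (Cubes.extendLeft n q) (fun _ => Cubes.extendRight m p)
  refine Cubes.ext_equiv e fun x y => ?_
  rw [Cubes.comp_apply, hyp, Cubes.comp_apply]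
  refine LittleCube.ext' (fun i => ?_) (fun i => ?_) <;>
  · refine Fin.addCases (fun i => ?_) (fun i => ?_) i <;>
      simp [Cubes.extendRight, Cubes.extendLeft, LittleCube.comp, LittleCube.extendRight,
        LittleCube.extendLeft]

/-- The morphism `μ : C_n ⊗ C_m → C_{n+m}` induced by `μ₁` and `μ₂`. -/
def mu (n m : ℕ) :
    TopOperad.Hom (TopOperad.tensor (littleCubes n) (littleCubes m)) (littleCubes (n + m)) :=
  TopOperad.tensorLift (mu₁ n m) (mu₂ n m) (interchange_mu n m)

/-- The space `(C_n | C_m)(j)`: the image of `μ` in arity `j`, as a subspace of `C_{n+m}(j)`. -/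
abbrev CubesBar (n m j : ℕ) : Type := Set.range ((mu n m).map j)

/-- The map `μ' : (C_n ⊗ C_m)(j) → (C_n | C_m)(j)`. -/
def muPrime (n m j : ℕ) :
    (TopOperad.tensor (littleCubes n) (littleCubes m)).Op j → CubesBar n m j :=
  Set.rangeFactorization ((mu n m).map j)

end

/-! In positive arity every operation of `C_n ⊗ C_m` is a tree-like composite: each internal vertex
is some `p ⊗ 1` or `1 ⊗ q` with at least two inputs, all of positive arity, and each leaf is a unary
`(p ⊗ 1) ∘ (1 ⊗ q)` (`BoardmanVogt.nested`). Unary vertices are pushed to the leaves by interchange;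
nullary ones are absorbed, because the tensor product has a single nullary operation. For fixed
arity only finitely many tree shapes occur, so if the labels range over compact sets, the composites
form a compact set (`TopOperad.isCompact_nested`).

On a compact set `K` of configurations all side lengths are at least some `ε > 0`. Sides multiply
under composition and never exceed 1, so every label of a tree lying over `K` also has sides at
least `ε` (`Cubes.SideGE.nested`), and such labels form compact sets (`Cubes.isCompact_sideGE`). The
preimage of `K` is thus a closed subset of a compact set. -/

noncomputable section

universe u v w

/-! ### Bijections indexing operadic composites. -/

/-- The bijection underlying the associativity of operadic composition. -/
def sigmaReassoc {k j : ℕ} {a : Fin k → ℕ} (f : (Σ i : Fin k, Fin (a i)) ≃ Fin j)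
    (b : Fin j → ℕ) {c : Fin k → ℕ}
    (g : ∀ i : Fin k, (Σ x : Fin (a i), Fin (b (f ⟨i, x⟩))) ≃ Fin (c i)) :
    (Σ s : Fin j, Fin (b s)) ≃ (Σ i : Fin k, Fin (c i)) :=
  (Equiv.sigmaCongrLeft (β := fun s => Fin (b s)) f).symm.trans
    ((Equiv.sigmaAssoc fun i x => Fin (b (f ⟨i, x⟩))).trans (Equiv.sigmaCongrRight g))

theorem sigmaReassoc_apply {k j : ℕ} {a : Fin k → ℕ} (f : (Σ i : Fin k, Fin (a i)) ≃ Fin j)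
    (b : Fin j → ℕ) {c : Fin k → ℕ}
    (g : ∀ i : Fin k, (Σ x : Fin (a i), Fin (b (f ⟨i, x⟩))) ≃ Fin (c i))
    (i : Fin k) (x : Fin (a i)) (y : Fin (b (f ⟨i, x⟩))) :
    sigmaReassoc f b g ⟨f ⟨i, x⟩, y⟩ = ⟨i, g i ⟨x, y⟩⟩ := by
  have : (Equiv.sigmaCongrLeft (β := fun s => Fin (b s)) f).symm ⟨f ⟨i, x⟩, y⟩ =
      ⟨⟨i, x⟩, y⟩ := (Equiv.symm_apply_eq _).2 rfl
  simp only [sigmaReassoc, Equiv.trans_apply, this]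
  rfl

/-- A disjoint union indexed by `Fin 1`. -/
def sigmaFinOne (j : ℕ) : (Σ _ : Fin 1, Fin j) ≃ Fin j where
  toFun s := s.2
  invFun x := ⟨0, x⟩
  left_inv := by rintro ⟨i, x⟩; rw [Subsingleton.elim i 0]
  right_inv _ := rfl

/-- A disjoint union of copies of `Fin 1`. -/
def sigmaConstFinOne (k : ℕ) : (Σ _ : Fin k, Fin 1) ≃ Fin k where
  toFun s := s.1
  invFun x := ⟨x, 0⟩
  left_inv := by rintro ⟨i, x⟩; rw [Subsingleton.elim x 0]
  right_inv _ := rfl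

/-! ### Normal form of composites of two interchanging morphisms. -/

namespace Operad

variable {P : Operad.{u}} {Q : Operad.{v}} {R : Operad.{w}}

/-- The outer relabelling in `assoc` is determined by the other three; solving for it makes
associativity usable without a compatibility proof. `comp_nested` solves for the relabelling on the
other side. -/
theorem comp_comp (R : Operad.{w}) {k j l : ℕ} {a : Fin k → ℕ}
    (f : (Σ i : Fin k, Fin (a i)) ≃ Fin j)
    (b : Fin j → ℕ) (e : (Σ s : Fin j, Fin (b s)) ≃ Fin l) {c : Fin k → ℕ}
    (g : ∀ i : Fin k, (Σ x : Fin (a i), Fin (b (f ⟨i, x⟩))) ≃ Fin (c i))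
    (p : R.Op k) (q : ∀ i, R.Op (a i)) (r : ∀ s, R.Op (b s)) :
    R.comp b e (R.comp a f p q) r =
      R.comp c ((sigmaReassoc f b g).symm.trans e) p (fun i =>
        R.comp (fun x => b (f ⟨i, x⟩)) (g i) (q i) (fun x => r (f ⟨i, x⟩))) :=
  R.assoc a f b e c g _ (fun i x y => by
    rw [Equiv.trans_apply, ← sigmaReassoc_apply f b g, Equiv.symm_apply_apply]) p q r

theorem comp_nested (R : Operad.{w}) {k j l : ℕ} {a : Fin k → ℕ}
    (f : (Σ i : Fin k, Fin (a i)) ≃ Fin j)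
    (b : Fin j → ℕ) {c : Fin k → ℕ}
    (g : ∀ i : Fin k, (Σ x : Fin (a i), Fin (b (f ⟨i, x⟩))) ≃ Fin (c i))
    (h : (Σ i : Fin k, Fin (c i)) ≃ Fin l)
    (p : R.Op k) (q : ∀ i, R.Op (a i)) (r : ∀ s, R.Op (b s)) :
    R.comp c h p (fun i =>
        R.comp (fun x => b (f ⟨i, x⟩)) (g i) (q i) (fun x => r (f ⟨i, x⟩))) =
      R.comp b ((sigmaReassoc f b g).trans h) (R.comp a f p q) r :=
  (R.assoc a f b _ c g h (fun i x y => by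
    rw [Equiv.trans_apply, sigmaReassoc_apply f b g]) p q r).symm

/-- Iterated composites of operations coming from `P` (subject to the condition `A`) and from `Q`
(subject to the condition `B`), in which unary operations occur only at the inputs and there are
no nullary operations. -/
inductive Nested (f : Hom P R) (g : Hom Q R) (A : ∀ k, P.Op k → Prop) (B : ∀ k, Q.Op k → Prop) :
    ∀ j, R.Op j → Prop
  | leaf {j : ℕ} (e : (Σ _ : Fin 1, Fin 1) ≃ Fin j) (p : P.Op 1) (q : Q.Op 1)
      (hp : A 1 p) (hq : B 1 q) :
      Nested f g A B j (R.comp (fun _ => 1) e (f.map 1 p) (fun _ => g.map 1 q))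
  | left {k j : ℕ} (hk : 2 ≤ k) (a : Fin k → ℕ) (ha : ∀ i, 1 ≤ a i)
      (e : (Σ i : Fin k, Fin (a i)) ≃ Fin j) (p : P.Op k) (hp : A k p) (x : ∀ i, R.Op (a i))
      (hx : ∀ i, Nested f g A B (a i) (x i)) : Nested f g A B j (R.comp a e (f.map k p) x)
  | right {k j : ℕ} (hk : 2 ≤ k) (a : Fin k → ℕ) (ha : ∀ i, 1 ≤ a i)
      (e : (Σ i : Fin k, Fin (a i)) ≃ Fin j) (q : Q.Op k) (hq : B k q) (x : ∀ i, R.Op (a i))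
      (hx : ∀ i, Nested f g A B (a i) (x i)) : Nested f g A B j (R.comp a e (g.map k q) x)

open BoardmanVogt

theorem _root_.BoardmanVogt.Interchange.symm {f : Hom P R} {g : Hom Q R} (h : Interchange f g) :
    Interchange g f :=
  fun e e' he q p => (h e' e (fun x y => (he y x).symm) p q).symm

theorem _root_.BoardmanVogt.Interchange.unary {f : Hom P R} {g : Hom Q R} (h : Interchange f g)
    {j : ℕ} (e : (Σ _ : Fin 1, Fin 1) ≃ Fin j) (p : P.Op 1) (q : Q.Op 1) :
    R.comp (fun _ => 1) e (f.map 1 p) (fun _ => g.map 1 q) =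
      R.comp (fun _ => 1) e (g.map 1 q) (fun _ => f.map 1 p) :=
  h e e (fun x y => by rw [Subsingleton.elim x y]) p q

/-- Only leaves treat `P` and `Q` asymmetrically, and unary operations commute. Hence it suffices to
prove closure properties for operations of `P`. -/
theorem Nested.symm {f : Hom P R} {g : Hom Q R} (hfg : Interchange f g)
    {A : ∀ k, P.Op k → Prop} {B : ∀ k, Q.Op k → Prop} {j : ℕ} {x : R.Op j}
    (h : Nested f g A B j x) : Nested g f B A j x := by
  induction h with
  | leaf e p q hp hq =>
    rw [hfg.unary]
    exact .leaf e q p hq hp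
  | left hk a ha e p hp x _ ih => exact .right hk a ha e p hp x ih
  | right hk a ha e p hp x _ ih => exact .left hk a ha e p hp x ih

/-- The composite of a unary operation with a nested one is nested. -/
theorem Nested.unary_comp {f : Hom P R} {g : Hom Q R} (hfg : Interchange f g) {j : ℕ} {x : R.Op j}
    (h : Nested f g (fun _ _ => True) (fun _ _ => True) j x) (p : P.Op 1) {l : ℕ}
    (e : (Σ _ : Fin 1, Fin j) ≃ Fin l) :
    Nested f g (fun _ _ => True) (fun _ _ => True) l
      (R.comp (fun _ => j) e (f.map 1 p) (fun _ => x)) := by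
  induction h generalizing l with
  | leaf e₀ p₀ q₀ _ _ =>
    have := R.comp_nested (sigmaFinOne 1) (fun _ => 1) (fun _ => e₀) e (f.map 1 p)
      (fun _ => f.map 1 p₀) (fun _ => g.map 1 q₀)
    rw [this, ← f.map_comp]
    exact .leaf _ _ _ trivial trivial
  | @left k j hk a ha e₀ p₀ _ x hx ih =>
    have := R.comp_nested (sigmaFinOne k) a (fun _ => e₀) e (f.map 1 p)
      (fun _ => f.map k p₀) x
    exact this ▸ f.map_comp _ _ _ _ ▸ .left hk _ ha _ _ trivial _ hx
  | @right k j hk a ha e₀ q₀ _ x hx ih =>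
    -- When the root comes from `P`, it absorbs `p`. Here it comes from `Q`, so interchange moves a
    -- copy of `p` into each of its inputs, where induction applies.
    have h₁ := R.comp_nested (sigmaFinOne k) a (fun _ => e₀) e (f.map 1 p)
      (fun _ => g.map k q₀) x
    have h₂ := hfg (sigmaFinOne k) (sigmaConstFinOne k) (fun _ _ => rfl) p q₀
    have h₃ := R.comp_comp (sigmaConstFinOne k) a
      ((sigmaReassoc (sigmaFinOne k) a (fun _ => e₀)).trans e)
      (fun i => sigmaFinOne (a i)) (g.map k q₀) (fun _ => f.map 1 p) x
    rw [← h₂] at h₃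
    exact (h₁.trans h₃) ▸ .right hk _ ha _ _ trivial _ (fun i => ih i _)

/-- The composite of an operation of `P` with nested ones is nested if no input is used up. -/
theorem Nested.comp_of_pos {f : Hom P R} {g : Hom Q R} (hfg : Interchange f g) {k j : ℕ}
    (hj : 1 ≤ j) (p : P.Op k) (a : Fin k → ℕ) (ha : ∀ i, 1 ≤ a i)
    (e : (Σ i : Fin k, Fin (a i)) ≃ Fin j) (x : ∀ i, R.Op (a i))
    (hx : ∀ i, Nested f g (fun _ _ => True) (fun _ _ => True) (a i) (x i)) :
    Nested f g (fun _ _ => True) (fun _ _ => True) j (R.comp a e (f.map k p) x) := by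
  obtain rfl | rfl | hk : k = 0 ∨ k = 1 ∨ 2 ≤ k := by omega
  · exact (e.symm ⟨0, hj⟩).1.elim0
  · obtain ⟨b, rfl⟩ : ∃ b, a = fun _ => b := ⟨a 0, funext fun i => by rw [Subsingleton.elim i 0]⟩
    obtain ⟨y, rfl⟩ : ∃ y, x = fun _ => y := ⟨x 0, funext fun i => by rw [Subsingleton.elim i 0]⟩
    exact (hx 0).unary_comp hfg p e
  · exact .left hk a ha e p trivial x hx

/-- The arity to which an input is cut down when inputs of arity zero are plugged. -/
def plugArity : ℕ → ℕ
  | 0 => 0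
  | _ + 1 => 1

/-- The identity for positive arity, a nullary operation otherwise. -/
def plug (P : Operad.{u}) (z : P.Op 0) : ∀ a, P.Op (plugArity a)
  | 0 => z
  | _ + 1 => P.one

theorem pos_of_fin_plugArity {a : ℕ} (x : Fin (plugArity a)) : 1 ≤ a := by
  cases a with
  | zero => exact x.elim0
  | succ a => omega

/-- A disjoint union of `plugArity a` copies of `Fin a`. -/
def plugEquiv (a : ℕ) (b : Fin (plugArity a) → ℕ) (hb : ∀ x, b x = a) :
    (Σ x : Fin (plugArity a), Fin (b x)) ≃ Fin a :=
  Equiv.ofBijective (fun s => Fin.cast (hb s.1) s.2) <| by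
    obtain rfl : b = fun _ => a := funext hb
    cases a with
    | zero => exact ⟨fun s => s.1.elim0, fun s => s.elim0⟩
    | succ a => exact (sigmaFinOne (a + 1)).bijective

/-- In positive arity the plug is the identity; in arity zero uniqueness of the nullary operation
decides. Heterogeneous equality is needed because `b i` equals `a` only propositionally. -/
theorem comp_plug [Subsingleton (R.Op 0)] (f : Hom P R) (z : P.Op 0) (a : ℕ) (x : R.Op a)
    (b : Fin (plugArity a) → ℕ) (hb : ∀ x, b x = a) (y : ∀ x, R.Op (b x))
    (hy : ∀ i, y i ≍ x) :
    R.comp b (plugEquiv a b hb) (f.map _ (P.plug z a)) y = x := by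
  obtain rfl : b = fun _ => a := funext hb
  obtain rfl : y = fun _ => x := funext fun i => eq_of_heq (hy i)
  cases a with
  | zero => exact Subsingleton.elim _ _
  | succ a =>
    change R.comp (fun _ : Fin 1 => a + 1) _ (f.map 1 P.one) (fun _ => x) = x
    rw [f.map_one]
    exact R.one_comp _ (fun _ => rfl) x

/-- The composite of an operation of `P` with nested ones is nested. -/
theorem Nested.comp {f : Hom P R} {g : Hom Q R} (hfg : Interchange f g) [Subsingleton (R.Op 0)]
    (z : P.Op 0) {k j : ℕ} (hj : 1 ≤ j) (p : P.Op k) (a : Fin k → ℕ)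
    (e : (Σ i : Fin k, Fin (a i)) ≃ Fin j) (x : ∀ i, R.Op (a i))
    (hx : ∀ i, 1 ≤ a i → Nested f g (fun _ _ => True) (fun _ _ => True) (a i) (x i)) :
    Nested f g (fun _ _ => True) (fun _ _ => True) j (R.comp a e (f.map k p) x) := by
  -- Composing `p` with the plugs fills its inputs of arity zero and keeps the others. The result is
  -- still an operation of `P`, now with inputs of positive arity only, as `Nested.comp_of_pos`
  -- requires.
  let F := finSigmaFinEquiv (n := fun i => plugArity (a i))
  let b := fun s => a (F.symm s).1
  have hb : ∀ i y, b (F ⟨i, y⟩) = a i := fun i y => by simp only [b, F.symm_apply_apply]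
  have key := R.comp_nested F b (fun i => plugEquiv (a i) (fun y => b (F ⟨i, y⟩)) (hb i)) e
    (f.map k p) (fun i => f.map _ (P.plug z (a i))) (fun s => x (F.symm s).1)
  have hx' : (fun i => R.comp (fun y => b (F ⟨i, y⟩))
      (plugEquiv (a i) (fun y => b (F ⟨i, y⟩)) (hb i)) (f.map _ (P.plug z (a i)))
      (fun y => x (F.symm (F ⟨i, y⟩)).1)) = x := by
    funext i
    refine comp_plug f z _ _ _ _ _ fun y => ?_
    exact congr_arg_heq x (congrArg Sigma.fst (F.symm_apply_apply ⟨i, y⟩))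
  rw [hx', ← f.map_comp] at key
  rw [key]
  have hpos : ∀ s, 1 ≤ b s := fun s => pos_of_fin_plugArity (F.symm s).2
  exact Nested.comp_of_pos hfg hj _ b hpos _ _ fun s => hx _ (hpos s)

/-- The empty disjoint union. -/
def sigmaFinZero (k : ℕ) : (Σ _ : Fin k, Fin 0) ≃ Fin 0 where
  toFun s := s.2
  invFun x := x.elim0
  left_inv s := s.2.elim0
  right_inv x := x.elim0

theorem comp_nullary (R : Operad.{w}) {j : ℕ} {a b : Fin 0 → ℕ}
    (e : (Σ i : Fin 0, Fin (a i)) ≃ Fin j) (e' : (Σ i : Fin 0, Fin (b i)) ≃ Fin j)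
    (p : R.Op 0) (x : ∀ i, R.Op (a i)) (y : ∀ i, R.Op (b i)) :
    R.comp a e p x = R.comp b e' p y := by
  obtain rfl : a = b := funext fun i => i.elim0
  obtain rfl : x = y := funext fun i => i.elim0
  obtain rfl : e = e' := Equiv.ext fun s => s.1.elim0
  rfl

theorem comp_map_nullary (f : Hom P R) [Subsingleton (P.Op 0)] (z : P.Op 0) {k : ℕ} (p : P.Op k)
    (e : (Σ _ : Fin k, Fin 0) ≃ Fin 0) :
    R.comp (fun _ => 0) e (f.map k p) (fun _ => f.map 0 z) = f.map 0 z := by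
  rw [← f.map_comp, Subsingleton.elim (P.comp _ _ _ _) z]

/-- An Eckmann–Hilton argument: interchange for two nullary operations equates them, each composed
with an empty family of inputs. -/
theorem map_nullary_eq {f : Hom P R} {g : Hom Q R} (hfg : Interchange f g)
    [Subsingleton (P.Op 0)] [Subsingleton (Q.Op 0)] (z : P.Op 0) (z' : Q.Op 0) :
    f.map 0 z = g.map 0 z' := by
  rw [← comp_map_nullary f z z (sigmaFinZero 0), ← comp_map_nullary g z' z' (sigmaFinZero 0)]
  exact (R.comp_nullary _ _ _ _ _).trans <|
    (hfg (sigmaFinZero 0) (sigmaFinZero 0) (fun x => x.elim0) z z').trans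
      (R.comp_nullary _ _ _ _ _)

theorem comp_eval_nullary {f : Hom P R} {g : Hom Q R} (hfg : Interchange f g)
    [Subsingleton (P.Op 0)] [Subsingleton (Q.Op 0)] (z : P.Op 0) (z' : Q.Op 0) {k : ℕ}
    (t : Word P Q k) (e : (Σ _ : Fin k, Fin 0) ≃ Fin 0) :
    R.comp (fun _ => 0) e (t.eval f g) (fun _ => f.map 0 z) = f.map 0 z := by
  induction t with
  | one => exact R.one_comp e (fun x => x.elim0) _
  | inl p => exact comp_map_nullary f z p e
  | inr q =>
    rw [map_nullary_eq hfg z z']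
    exact comp_map_nullary g z' q e
  | @comp k j a e' t s iht ihs =>
    have := R.comp_comp e' (fun _ => 0) e (c := fun _ => 0)
      (fun i => sigmaFinZero (a i)) (t.eval f g) (fun i => (s i).eval f g)
      (fun _ => f.map 0 z)
    refine this.trans ?_
    simp only [ihs]
    exact iht _

/-- A word of arity zero is unchanged by filling its empty set of inputs with the nullary operation,
yet by `comp_eval_nullary` such a filling collapses every word to that operation. -/
theorem subsingleton_nullary {f : Hom P R} {g : Hom Q R} (hfg : Interchange f g)
    [Subsingleton (P.Op 0)] [Subsingleton (Q.Op 0)] (z : P.Op 0) (z' : Q.Op 0)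
    (hgen : ∀ x : R.Op 0, ∃ t : Word P Q 0, t.eval f g = x) : Subsingleton (R.Op 0) := by
  refine ⟨fun x y => ?_⟩
  have key : ∀ x : R.Op 0, x = f.map 0 z := fun x => by
    obtain ⟨t, rfl⟩ := hgen x
    rw [← comp_eval_nullary hfg z z' t (sigmaFinZero 0)]
    exact (R.comp_one (sigmaConstFinOne 0) (fun i => i.elim0) _).symm.trans
      (R.comp_nullary _ _ _ _ _)
  rw [key x, key y]

/-- Composites of nested operations are nested. -/
theorem Nested.comp_eval {f : Hom P R} {g : Hom Q R} (hfg : Interchange f g)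
    [Subsingleton (R.Op 0)] (z : P.Op 0) (z' : Q.Op 0) {k : ℕ} (t : Word P Q k) {j : ℕ}
    (hj : 1 ≤ j) (a : Fin k → ℕ) (e : (Σ i : Fin k, Fin (a i)) ≃ Fin j) (x : ∀ i, R.Op (a i))
    (hx : ∀ i, 1 ≤ a i → Nested f g (fun _ _ => True) (fun _ _ => True) (a i) (x i)) :
    Nested f g (fun _ _ => True) (fun _ _ => True) j (R.comp a e (t.eval f g) x) := by
  induction t generalizing j with
  | one =>
    change Nested f g _ _ j (R.comp a e R.one x)
    rw [← f.map_one]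
    exact Nested.comp hfg z hj _ a e x hx
  | inl p => exact Nested.comp hfg z hj p a e x hx
  | inr q =>
    exact (Nested.comp hfg.symm z' hj q a e x fun i hi => (hx i hi).symm hfg).symm hfg.symm
  -- Reassociate `t ∘ s ∘ x` as `t ∘ (s ∘ x)`: induction handles the inner composites, then the
  -- outer one. Inner composites of arity zero need not be nested, hence the restriction to `1 ≤ a
  -- i` in `hx`.
  | @comp k l b e' t s iht ihs =>
    have := R.comp_comp e' a e (fun _ => finSigmaFinEquiv) (t.eval f g)
      (fun i => (s i).eval f g) x
    exact this ▸ iht hj _ _ _ fun i hi => ihs i hi _ _ _ fun y hy => hx _ hy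

/-- Compose with identities at all inputs; the identity is the leaf built from the two units. -/
theorem Nested.eval {f : Hom P R} {g : Hom Q R} (hfg : Interchange f g)
    [Subsingleton (R.Op 0)] (z : P.Op 0) (z' : Q.Op 0) {j : ℕ} (t : Word P Q j) (hj : 1 ≤ j) :
    Nested f g (fun _ _ => True) (fun _ _ => True) j (t.eval f g) := by
  rw [← R.comp_one (sigmaConstFinOne j) (fun _ => rfl) (t.eval f g)]
  refine Nested.comp_eval hfg z z' t hj _ _ _ fun _ _ => ?_
  have := Nested.leaf (f := f) (g := g) (A := fun _ _ => True) (B := fun _ _ => True)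
    (sigmaFinOne 1) P.one Q.one trivial trivial
  rwa [f.map_one, g.map_one, R.one_comp (sigmaFinOne 1) (fun _ => rfl)] at this

end Operad

theorem BoardmanVogt.eval_inl_inr {P : Operad.{u}} {Q : Operad.{v}} {j : ℕ} (t : Word P Q j) :
    t.eval (inl P Q) (inr P Q) = mk t := by
  induction t with
  | one => rfl
  | inl p => rfl
  | inr q => rfl
  | comp a e t s iht ihs =>
    simp only [Word.eval, iht, ihs]
    exact tcomp_mk a e t s

theorem BoardmanVogt.interchange_inl_inr (P : Operad.{u}) (Q : Operad.{v}) :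
    Interchange (inl P Q) (inr P Q) := fun e e' hyp p q =>
  (tcomp_mk _ e _ _).trans ((mk_eq (.interchange e e' hyp p q)).trans (tcomp_mk _ e' _ _).symm)

/-- Every operation of positive arity in a Boardman–Vogt tensor product of operads with exactly one
nullary operation is nested. -/
theorem BoardmanVogt.nested {P : Operad.{u}} {Q : Operad.{v}} [Unique (P.Op 0)] [Unique (Q.Op 0)]
    {j : ℕ} (hj : 1 ≤ j) (x : TOp P Q j) :
    Operad.Nested (inl P Q) (inr P Q) (fun _ _ => True) (fun _ _ => True) j x := by
  have : Subsingleton ((tensorOperad P Q).Op 0) :=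
    Operad.subsingleton_nullary (interchange_inl_inr P Q) default default
      fun x => ⟨rep x, (eval_inl_inr _).trans (mk_rep x)⟩
  rw [← mk_rep x, ← eval_inl_inr]
  exact Operad.Nested.eval (interchange_inl_inr P Q) default default _ hj

/-! ### Compactness of nested composites with compact label sets. -/

namespace TopOperad

variable {P : TopOperad.{u}} {Q : TopOperad.{v}} {R : TopOperad.{w}}

theorem isCompact_nested_comp (f : Hom P R) {k j : ℕ} (a : Fin k → ℕ)
    (e : (Σ i : Fin k, Fin (a i)) ≃ Fin j) {S : Set (P.Op k)} (hS : IsCompact S)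
    {T : ∀ i, Set (R.Op (a i))} (hT : ∀ i, IsCompact (T i)) :
    IsCompact ((fun x : P.Op k × (∀ i, R.Op (a i)) => R.comp a e (f.map k x.1) x.2) ''
      (S ×ˢ Set.univ.pi T)) :=
  (hS.prod (isCompact_univ_pi hT)).image <| (R.isOperadTopology a e).comp <|
    ((f.continuous_map k).comp continuous_fst).prodMk continuous_snd

/-- Strong induction on the arity: since a vertex has at least two inputs, all of positive arity,
each input has arity smaller than `j`. -/
theorem isCompact_nested (f : Hom P R) (g : Hom Q R) {A : ∀ k, P.Op k → Prop}
    {B : ∀ k, Q.Op k → Prop} (hA : ∀ k, IsCompact {p | A k p}) (hB : ∀ k, IsCompact {q | B k q})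
    (j : ℕ) : IsCompact {x | Operad.Nested f.toHom g.toHom A B j x} := by
  induction j using Nat.strong_induction_on with
  | _ j ih =>
  let N := fun i => {x : R.Op i | Operad.Nested f.toHom g.toHom A B i x}
  -- The possible shapes of a root vertex. The bounds `k ≤ j` and `a i < j`, justified by `hlt`,
  -- make this type finite, so the unions below are finite.
  let ι := {s : Σ k : Fin (j + 1), Σ a : Fin k.1 → Fin j, (Σ i : Fin k.1, Fin (a i).1) ≃ Fin j //
    2 ≤ s.1.1 ∧ ∀ i, 1 ≤ (s.2.1 i).1}
  let L : Set (R.Op j) := ⋃ e : (Σ _ : Fin 1, Fin 1) ≃ Fin j,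
    (fun x : P.Op 1 × (Fin 1 → R.Op 1) => R.comp (fun _ => 1) e (f.map 1 x.1) x.2) ''
      ({p | A 1 p} ×ˢ Set.univ.pi fun _ => g.map 1 '' {q | B 1 q})
  let X : Set (R.Op j) := ⋃ s : ι,
    (fun x : P.Op s.1.1 × (∀ i, R.Op (s.1.2.1 i)) => R.comp _ s.1.2.2 (f.map s.1.1 x.1) x.2) ''
      ({p | A s.1.1 p} ×ˢ Set.univ.pi fun i => N (s.1.2.1 i))
  let Y : Set (R.Op j) := ⋃ s : ι,
    (fun x : Q.Op s.1.1 × (∀ i, R.Op (s.1.2.1 i)) => R.comp _ s.1.2.2 (g.map s.1.1 x.1) x.2) ''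
      ({p | B s.1.1 p} ×ˢ Set.univ.pi fun i => N (s.1.2.1 i))
  have hL : IsCompact L := isCompact_iUnion fun e =>
    isCompact_nested_comp f _ e (hA 1) fun _ => (hB 1).image (g.continuous_map 1)
  have hX : IsCompact X := isCompact_iUnion fun s =>
    isCompact_nested_comp f _ s.1.2.2 (hA _) fun i => ih _ (s.1.2.1 i).2
  have hY : IsCompact Y := isCompact_iUnion fun s =>
    isCompact_nested_comp g _ s.1.2.2 (hB _) fun i => ih _ (s.1.2.1 i).2
  have hlt : ∀ {k : ℕ} (_ : 2 ≤ k) (a : Fin k → ℕ) (_ : ∀ i, 1 ≤ a i)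
      (_ : (Σ i : Fin k, Fin (a i)) ≃ Fin j), k < j + 1 ∧ ∀ i, a i < j := by
    intro k hk a ha e
    have hsum : ∑ i, a i = j := by simpa using Fintype.card_congr e
    have hle : ∑ _i : Fin k, 1 ≤ ∑ i, a i := Finset.sum_le_sum fun i _ => ha i
    refine ⟨by simp at hle; omega, fun i => ?_⟩
    have : Nontrivial (Fin k) := Fin.nontrivial_iff_two_le.2 hk
    obtain ⟨i', hi'⟩ := exists_ne i
    have h := Finset.add_le_sum (f := a) (s := Finset.univ) (fun _ _ => Nat.zero_le _)
      (Finset.mem_univ i) (Finset.mem_univ i') hi'.symm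
    have := ha i'
    omega
  suffices {x | Operad.Nested f.toHom g.toHom A B j x} = L ∪ (X ∪ Y) from
    this ▸ hL.union (hX.union hY)
  refine Set.Subset.antisymm ?_ (Set.union_subset ?_ (Set.union_subset ?_ ?_))
  · intro x hx
    cases hx with
    | leaf e p q hp hq =>
      exact .inl (Set.mem_iUnion.2 ⟨e, (p, fun _ => g.map 1 q), ⟨hp, fun _ _ => ⟨q, hq, rfl⟩⟩, rfl⟩)
    | left hk a ha e p hp x hx =>
      obtain ⟨h₁, h₂⟩ := hlt hk a ha e
      exact .inr (.inl (Set.mem_iUnion.2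
        ⟨⟨⟨⟨_, h₁⟩, fun i => ⟨a i, h₂ i⟩, e⟩, hk, ha⟩, (p, x), ⟨hp, fun i _ => hx i⟩, rfl⟩))
    | right hk a ha e p hp x hx =>
      obtain ⟨h₁, h₂⟩ := hlt hk a ha e
      exact .inr (.inr (Set.mem_iUnion.2
        ⟨⟨⟨⟨_, h₁⟩, fun i => ⟨a i, h₂ i⟩, e⟩, hk, ha⟩, (p, x), ⟨hp, fun i _ => hx i⟩, rfl⟩))
  · refine Set.iUnion_subset fun e => ?_
    rintro _ ⟨⟨p, x⟩, ⟨hp, hx⟩, rfl⟩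
    choose q hq hqx using fun i => hx i trivial
    obtain rfl : (fun _ => g.map 1 (q 0)) = x :=
      funext fun i => by rw [Subsingleton.elim i 0]; exact hqx 0
    exact .leaf e p (q 0) hp (hq 0)
  · refine Set.iUnion_subset fun s => ?_
    rintro _ ⟨⟨p, x⟩, ⟨hp, hx⟩, rfl⟩
    exact .left s.2.1 _ s.2.2 _ p hp x fun i => hx i trivial
  · refine Set.iUnion_subset fun s => ?_
    rintro _ ⟨⟨p, x⟩, ⟨hp, hx⟩, rfl⟩
    exact .right s.2.1 _ s.2.2 _ p hp x fun i => hx i trivial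

end TopOperad

/-! ### Compact sets of little cubes and of configurations. -/

namespace LittleCube

variable {n : ℕ}

theorem mem_image_iff (c : LittleCube n) (x : Fin n → ℝ) :
    x ∈ c.image ↔ ∀ i, c.1.1 i < x i ∧ x i < c.1.1 i + c.1.2 i := by
  constructor
  · rintro ⟨y, hy, rfl⟩ i
    have hb := (c.2 i).2.1
    have := mul_pos hb (hy i).1
    have := mul_lt_mul_of_pos_left (hy i).2 hb
    simp only [toFun]
    constructor <;> linarith
  · intro h
    refine ⟨fun i => (x i - c.1.1 i) / c.1.2 i, fun i => ?_, funext fun i => ?_⟩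
    · have hb := (c.2 i).2.1
      exact ⟨div_pos (by linarith [h i]) hb, (div_lt_one hb).2 (by linarith [h i])⟩
    · have hb := (c.2 i).2.1
      simp only [toFun]
      field_simp
      ring

theorem isOpen_setOf_mem_image (x : Fin n → ℝ) : IsOpen {c : LittleCube n | x ∈ c.image} := by
  simp only [mem_image_iff, Set.ofPred_forall]
  refine isOpen_iInter_of_finite fun i => ?_
  have h₁ : Continuous fun c : LittleCube n => c.1.1 i := by fun_prop
  have h₂ : Continuous fun c : LittleCube n => c.1.2 i := by fun_prop
  exact (isOpen_lt h₁ continuous_const).inter (isOpen_lt continuous_const (h₁.add h₂))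

theorem side_le_one (c : LittleCube n) (i : Fin n) : c.1.2 i ≤ 1 := by
  linarith [(c.2 i).1, (c.2 i).2.2]

/-- The bound `ε` replaces the only non-closed condition, positivity of the sides, leaving a closed
subset of a box. -/
theorem isCompact_side_ge {ε : ℝ} (hε : 0 < ε) :
    IsCompact {c : LittleCube n | ∀ i, ε ≤ c.1.2 i} := by
  have hval : Topology.IsInducing (Subtype.val : LittleCube n → _) := ⟨rfl⟩
  rw [hval.isCompact_iff]
  have : Subtype.val '' {c : LittleCube n | ∀ i, ε ≤ c.1.2 i} =
      {c : (Fin n → ℝ) × (Fin n → ℝ) | ∀ i, 0 ≤ c.1 i ∧ ε ≤ c.2 i ∧ c.1 i + c.2 i ≤ 1} := by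
    ext c
    constructor
    · rintro ⟨d, hd, rfl⟩ i
      exact ⟨(d.2 i).1, hd i, (d.2 i).2.2⟩
    · intro h
      exact ⟨⟨c, fun i => ⟨(h i).1, hε.trans_le (h i).2.1, (h i).2.2⟩⟩, fun i => (h i).2.1, rfl⟩
  rw [this]
  refine (isCompact_Icc (a := ((0, 0) : (Fin n → ℝ) × (Fin n → ℝ))) (b := (1, 1))).of_isClosed_subset
    ?_ fun c h => ⟨⟨fun i => (h i).1, fun i => hε.le.trans (h i).2.1⟩, fun i => ?_, fun i => ?_⟩
  · simp only [Set.ofPred_forall, Set.ofPred_and]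
    refine isClosed_iInter fun i => (isClosed_le ?_ ?_).inter ((isClosed_le ?_ ?_).inter
      (isClosed_le ?_ ?_)) <;> fun_prop
  · simp only [Pi.one_apply]; linarith [h i]
  · simp only [Pi.one_apply]; linarith [h i]

end LittleCube

namespace Cubes

variable {n m : ℕ}

/-- Images are open cubes, so a point shared by two of them remains shared after a small
perturbation. -/
theorem isClosed_setOf_pairwise_disjoint (n j : ℕ) :
    IsClosed {c : Fin j → LittleCube n |
      Pairwise fun x y => Disjoint (c x).image (c y).image} := by
  simp only [Pairwise, Set.disjoint_left, Set.ofPred_forall]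
  refine isClosed_iInter fun x => isClosed_iInter fun y => isClosed_iInter fun _ =>
    isClosed_iInter fun s => ?_
  simp only [imp_iff_not_or, Set.ofPred_or]
  exact ((LittleCube.isOpen_setOf_mem_image s).preimage
    (continuous_apply (A := fun _ : Fin j => LittleCube n) x)).isClosed_compl.union
    ((LittleCube.isOpen_setOf_mem_image s).preimage
      (continuous_apply (A := fun _ : Fin j => LittleCube n) y)).isClosed_compl

/-- All side lengths are at least `ε`. -/
def SideGE (ε : ℝ) (j : ℕ) (c : Cubes n j) : Prop := ∀ x i, ε ≤ (c.1 x).1.2 i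

theorem isCompact_sideGE {ε : ℝ} (hε : 0 < ε) (j : ℕ) :
    IsCompact {c : Cubes n j | SideGE ε j c} := by
  have := (isClosed_setOf_pairwise_disjoint n j).isClosedEmbedding_subtypeVal.isCompact_preimage
    (isCompact_univ_pi fun _ : Fin j => LittleCube.isCompact_side_ge (n := n) hε)
  refine (congrArg IsCompact (Set.ext fun c => ?_)).mpr this
  simp [SideGE]

theorem exists_sideGE_of_isCompact {j : ℕ} {K : Set (Cubes n j)} (hK : IsCompact K) :
    ∃ ε > 0, ∀ c ∈ K, SideGE ε j c := by
  have key : ∀ x i, ∃ ε > 0, ∀ c ∈ K, ε ≤ (c.1 x).1.2 i := by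
    intro x i
    obtain rfl | hne := K.eq_empty_or_nonempty
    · exact ⟨1, one_pos, by simp⟩
    · have hcont : Continuous fun c : Cubes n j => (c.1 x).1.2 i :=
        (continuous_apply i).comp (continuous_cube j x).snd
      obtain ⟨c, _, hc⟩ := hK.exists_isMinOn hne hcont.continuousOn
      exact ⟨_, ((c.1 x).2 i).2.1, fun d hd => hc hd⟩
  choose ε hε h using key
  -- Taking any sufficiently small `δ > 0` avoids a minimum over an index set that may be empty.
  have : ∀ᶠ δ in nhdsWithin (0 : ℝ) (Set.Ioi 0), ∀ x i, δ ≤ ε x i :=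
    Filter.eventually_all.2 fun x => Filter.eventually_all.2 fun i =>
      Filter.mem_of_superset (Ioc_mem_nhdsGT (hε x i)) fun _ h => h.2
  obtain ⟨δ, h₁, h₂⟩ := (this.and self_mem_nhdsWithin).exists
  exact ⟨δ, h₂, fun c hc x i => (h₁ x i).trans (h x i c hc)⟩

/-- A product of sides at most 1 is bounded above by each factor. Positivity of the `a i` ensures
that every cube of `p` contributes to the composite. -/
theorem SideGE.of_comp {ε : ℝ} {k j : ℕ} {a : Fin k → ℕ} {e : (Σ i : Fin k, Fin (a i)) ≃ Fin j}
    {p : Cubes n k} {q : ∀ i, Cubes n (a i)} (h : SideGE ε j (comp a e p q))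
    (ha : ∀ i, 1 ≤ a i) : SideGE ε k p ∧ ∀ i, SideGE ε (a i) (q i) := by
  have key : ∀ i x s, ε ≤ (p.1 i).1.2 s * ((q i).1 x).1.2 s := fun i x s => by
    have := h (e ⟨i, x⟩) s
    rwa [comp_apply] at this
  refine ⟨fun i s => ?_, fun i x s => ?_⟩
  · have := key i ⟨0, ha i⟩ s
    exact this.trans (mul_le_of_le_one_right ((p.1 i).2 s).2.1.le (LittleCube.side_le_one _ s))
  · exact (key i x s).trans
      (mul_le_of_le_one_left (((q i).1 x).2 s).2.1.le (LittleCube.side_le_one _ s))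

theorem SideGE.of_extendRight {ε : ℝ} {j : ℕ} {c : Cubes n j}
    (h : SideGE ε j (extendRight m c)) : SideGE ε j c := fun x i => by
  simpa [extendRight, LittleCube.extendRight] using h x (Fin.castAdd m i)

theorem SideGE.of_extendLeft {ε : ℝ} {j : ℕ} {c : Cubes m j}
    (h : SideGE ε j (extendLeft n c)) : SideGE ε j c := fun x i => by
  simpa [extendLeft, LittleCube.extendLeft] using h x (Fin.natAdd n i)

instance : Unique (Cubes n 0) where
  default := ⟨fun x => x.elim0, fun x => x.elim0⟩
  uniq _ := Subtype.ext (funext fun x => x.elim0)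

/-- The operations used in a nested decomposition have sides at least as long as the cubes of the
configuration. -/
theorem SideGE.nested {ε : ℝ} {j : ℕ}
    {x : (TopOperad.tensor (littleCubes n) (littleCubes m)).Op j}
    (hx : Operad.Nested (BoardmanVogt.inl (littleCubes n).toOperad (littleCubes m).toOperad)
      (BoardmanVogt.inr (littleCubes n).toOperad (littleCubes m).toOperad)
      (fun _ _ => True) (fun _ _ => True) j x)
    (h : SideGE ε j ((mu n m).map j x)) :
    Operad.Nested (BoardmanVogt.inl (littleCubes n).toOperad (littleCubes m).toOperad)
      (BoardmanVogt.inr (littleCubes n).toOperad (littleCubes m).toOperad)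
      (SideGE ε) (SideGE ε) j x := by
  induction hx with
  | @leaf j e p q _ _ =>
    -- As `mu` is a morphism, the bound concerns a composite of configurations and passes to its
    -- factors; the same applies at the other vertices.
    have h' : SideGE ε j (comp (fun _ => 1) e (extendRight m p) fun _ => extendLeft n q) :=
      ((mu n m).map_comp _ e _ _).subst (motive := SideGE ε j) h
    exact .leaf e p q (h'.of_comp fun _ => le_rfl).1.of_extendRight
      ((h'.of_comp fun _ => le_rfl).2 0).of_extendLeft
  | @left k j hk a ha e p _ x _ ih =>
    have h' : SideGE ε j (comp a e (extendRight m p) fun i => (mu n m).map (a i) (x i)) :=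
      ((mu n m).map_comp a e _ x).subst (motive := SideGE ε j) h
    exact .left hk a ha e p (h'.of_comp ha).1.of_extendRight x fun i => ih i ((h'.of_comp ha).2 i)
  | @right k j hk a ha e q _ x _ ih =>
    have h' : SideGE ε j (comp a e (extendLeft n q) fun i => (mu n m).map (a i) (x i)) :=
      ((mu n m).map_comp a e _ x).subst (motive := SideGE ε j) h
    exact .right hk a ha e q (h'.of_comp ha).1.of_extendLeft x fun i => ih i ((h'.of_comp ha).2 i)

end Cubes

/-! ### Properness of the comparison map. -/

/-- The morphism `p ↦ p ⊗ 1` of topological operads. -/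
def TopOperad.tensorInl (P : TopOperad.{u}) (Q : TopOperad.{v}) : Hom P (tensor P Q) where
  toHom := BoardmanVogt.inl P.toOperad Q.toOperad
  continuous_map := (admissible_tensorTop P Q).2.1

/-- The morphism `q ↦ 1 ⊗ q` of topological operads. -/
def TopOperad.tensorInr (P : TopOperad.{u}) (Q : TopOperad.{v}) : Hom Q (tensor P Q) where
  toHom := BoardmanVogt.inr P.toOperad Q.toOperad
  continuous_map := (admissible_tensorTop P Q).2.2

end

theorem lemma3 (n m : ℕ) (hn : 1 ≤ n) (hm : 1 ≤ m) (j : ℕ) (hj : 1 ≤ j) :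
    Continuous (muPrime n m j) ∧
      ∀ K : Set (CubesBar n m j), IsCompact K → IsCompact (muPrime n m j ⁻¹' K) := by
  have hcont : Continuous (muPrime n m j) := ((mu n m).continuous_map j).subtype_mk _
  refine ⟨hcont, fun K hK => ?_⟩
  -- Hausdorffness is needed only in the target, where it makes `K` closed.
  have : T2Space ((littleCubes (n + m)).Op j) := inferInstanceAs (T2Space (Cubes (n + m) j))
  obtain ⟨ε, hε, h⟩ := Cubes.exists_sideGE_of_isCompact (hK.image continuous_subtype_val)
  refine (TopOperad.isCompact_nested (TopOperad.tensorInl (littleCubes n) (littleCubes m))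
    (TopOperad.tensorInr (littleCubes n) (littleCubes m)) (Cubes.isCompact_sideGE hε)
    (Cubes.isCompact_sideGE hε) j).of_isClosed_subset (hK.isClosed.preimage hcont) fun x hx => ?_
  have : Unique ((littleCubes n).Op 0) := inferInstanceAs (Unique (Cubes n 0))
  have : Unique ((littleCubes m).Op 0) := inferInstanceAs (Unique (Cubes m 0))
  exact Cubes.SideGE.nested (BoardmanVogt.nested hj x) (h _ ⟨_, hx, rfl⟩)
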